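/- Let $q$ be an odd prime power and $\ell\ge 1$ an odd integer, and put $F=\mathbb F_{q^{2\ell}}$ and $n=q^{2\ell+1}-q$. Let $\mathcal S$ be the generalized Hermitian curve $y^{q^\ell+1}=x^q+x$ over $F$, and consider the groups $$H_1=\{(x,y)\mapsto(x+a,y) : a\in F,\ a^q+a=0\},\qquad H_2=\{(x,y)\mapsto(x,\lambda y) : \lambda\in F,\ \lambda^{q^\ell+1}=1\},$$ acting on the affine $F$-rational points of $\mathcal S$. Let $G=H_1H_2$ and let $\mathcal P$ be the set of affine $F$-rational points of $\mathcal S$ whose $G$-orbit has $|G|$ elements. Let $t_1,t_2\ge 0$ be integers, put $$M_1=\max\{t_1,q^\ell-1\},\quad M_2=\max\{t_2,q-2\},\quad m_1=\min\{t_1,q^\ell-1\},\quad m_2=\min\{t_2,q-2\},$$ and assume that $$S:=M_1q+M_2(q^\ell+1)\le q^{2\ell+1}-q .$$ Let $\mathcal C\subseteq F^{\mathcal P}$ be the code of all vectors $(f(P))_{P\in\mathcal P}$, where $f$ runs over the functions $\sum_{i=0}^{m_1}\sum_{j=0}^{m_2}a_{i,j}x^jy^i$ with $a_{i,j}\in F$.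 Then $|H_1|=q$, $|H_2|=q^\ell+1$, and $\mathcal C$ is a $$[\,q^{2\ell+1}-q,\ (m_1+1)(m_2+1),\ \ge q^{2\ell+1}-q-S;\ q-1,\ q^\ell\,]\text{-recoverable code over }\mathbb F_{q^{2\ell}} .$$ That is: $\mathcal C$ has length $q^{2\ell+1}-q$, dimension $(m_1+1)(m_2+1)$ and minimum distance at least $q^{2\ell+1}-q-S$, and every coordinate $P$ has two disjoint repair sets, of cardinalities $q-1$ and $q^\ell$. Moreover, for each $P\in\mathcal P$ the sets $H_1P\setminus\{P\}$ and $H_2P\setminus\{P\}$ are repair sets. Here a repair set for a coordinate $P$ is a set $R$ of coordinates with $P\notin R$ such that the column at $P$ of a generator matrix of $\mathcal C$ is a linear combination of the columns indexed by $R$. -/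

import Mathlib

/-! ## Linear codes and locality -/

/-- `G` is a generator matrix of the linear code `C`: its rows form a basis of `C`. -/
def IsGeneratorMatrix {F ι : Type*} [Field F] {k : ℕ}
    (G : Matrix (Fin k) ι F) (C : Submodule F (ι → F)) : Prop :=
  LinearIndependent F G.row ∧ Submodule.span F (Set.range G.row) = C

/-- The minimum distance of a linear code: the least Hamming distance between two distinct
codewords (with value `0` for the zero code). -/
noncomputable def minDist {F ι : Type*} [Field F] [DecidableEq F] [Fintype ι]
    (C : Submodule F (ι → F)) : ℕ :=
  sInf {d : ℕ | ∃ u ∈ C, ∃ v ∈ C, u ≠ v ∧ hammingDist u v = d}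

/-- `R` is a repair set for the coordinate `i` of the code `C`: it does not contain `i`, and
the `i`-th column of a generator matrix of `C` is a linear combination of the columns
indexed by `R`. (The condition does not depend on the choice of the generator matrix.) -/
def IsRepairSet {F ι : Type*} [Field F] (C : Submodule F (ι → F)) (i : ι) (R : Set ι) : Prop :=
  i ∉ R ∧ ∀ (k : ℕ) (G : Matrix (Fin k) ι F), IsGeneratorMatrix G C →
    G.col i ∈ Submodule.span F (G.col '' R)

/-- The code `C` has `(r₁, …, r_δ)`-locality: every coordinate has pairwise disjoint repair
sets of cardinalities `r₁, …, r_δ`. -/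
def HasLocality {F ι : Type*} [Field F] [Fintype ι] (C : Submodule F (ι → F))
    {δ : ℕ} (r : Fin δ → ℕ) : Prop :=
  ∀ i : ι, ∃ R : Fin δ → Set ι,
    (∀ a b : Fin δ, a ≠ b → Disjoint (R a) (R b)) ∧
    ∀ j : Fin δ, (R j).ncard = r j ∧ IsRepairSet C i (R j)

/-- `C` is an `[n, k, ≥ d; r₁, …, r_δ]`-recoverable code. -/
structure IsRecoverableCode {F ι : Type*} [Field F] [DecidableEq F] [Fintype ι]
    (C : Submodule F (ι → F)) (n k d : ℕ) {δ : ℕ} (r : Fin δ → ℕ) : Prop where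
  length_eq : Fintype.card ι = n
  finrank_eq : Module.finrank F C = k
  le_minDist : d ≤ minDist C
  locality : HasLocality C r

/-! ## The generalized Hermitian curve `y ^ (q ^ ℓ + 1) = x ^ q + x` -/

namespace GenHermitian

/-- The affine `F`-rational points `(x, y)` of the curve. -/
def Point (F : Type*) [Field F] (q ℓ : ℕ) : Type _ :=
  {P : F × F // P.2 ^ (q ^ ℓ + 1) = P.1 ^ q + P.1}

instance {F : Type*} [Field F] [Finite F] {q ℓ : ℕ} : Finite (Point F q ℓ) :=
  inferInstanceAs (Finite {P : F × F // P.2 ^ (q ^ ℓ + 1) = P.1 ^ q + P.1})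

/-- The defining polynomial `Y ^ (q ^ ℓ + 1) - (X ^ q + X)`, where `X` is the variable of
index `0` and `Y` that of index `1`. -/
noncomputable def curvePoly (F : Type*) [Field F] (q ℓ : ℕ) : MvPolynomial (Fin 2) F :=
  MvPolynomial.X 1 ^ (q ^ ℓ + 1) - (MvPolynomial.X 0 ^ q + MvPolynomial.X 0)

/-- The ring of regular functions on the affine part of the curve. -/
abbrev CoordRing (F : Type*) [Field F] (q ℓ : ℕ) : Type _ :=
  MvPolynomial (Fin 2) F ⧸ Ideal.span {curvePoly F q ℓ}

/-- The coordinate function `x`. -/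
noncomputable def x (F : Type*) [Field F] (q ℓ : ℕ) : CoordRing F q ℓ :=
  Ideal.Quotient.mk _ (MvPolynomial.X 0)

/-- The coordinate function `y`. -/
noncomputable def y (F : Type*) [Field F] (q ℓ : ℕ) : CoordRing F q ℓ :=
  Ideal.Quotient.mk _ (MvPolynomial.X 1)

/-- The value `f ↦ f(P)` of regular functions at an affine rational point. -/
noncomputable def evalAt {F : Type*} [Field F] {q ℓ : ℕ} (P : Point F q ℓ) :
    CoordRing F q ℓ →ₐ[F] F :=
  Ideal.Quotient.liftₐ (Ideal.span {curvePoly F q ℓ})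
    (MvPolynomial.aeval ![P.1.1, P.1.2]) (by
      intro f hf
      obtain ⟨g, rfl⟩ := Ideal.mem_span_singleton'.mp hf
      have hP := P.2
      simp [curvePoly, hP])

theorem evalAt_x {F : Type*} [Field F] {q ℓ : ℕ} (P : Point F q ℓ) :
    evalAt P (x F q ℓ) = P.1.1 := by
  simp [evalAt, x]

theorem evalAt_y {F : Type*} [Field F] {q ℓ : ℕ} (P : Point F q ℓ) :
    evalAt P (y F q ℓ) = P.1.2 := by
  simp [evalAt, y]

/-- The origin `(0, 0)`, which lies on the curve. -/
def origin (F : Type*) [Field F] (q ℓ : ℕ) [NeZero q] : Point F q ℓ :=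
  ⟨(0, 0), by simp [NeZero.ne q]⟩

/-- The group of translations `(x, y) ↦ (x + a, y)` with `a ^ q + a = 0`. -/
def translationGroup (F : Type*) [Field F] (q ℓ : ℕ) [NeZero q] :
    Subgroup (Equiv.Perm (Point F q ℓ)) where
  carrier := {σ | ∃ a : F, a ^ q + a = 0 ∧ ∀ P, (σ P).1 = (P.1.1 + a, P.1.2)}
  one_mem' := ⟨0, by simp [NeZero.ne q], fun P => by simp⟩
  mul_mem' := by
    rintro σ τ ⟨a, -, hσ⟩ ⟨b, -, hτ⟩
    have h : ∀ P, ((σ * τ) P).1 = (P.1.1 + (b + a), P.1.2) := fun P => by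
      simp [hσ, hτ, add_assoc]
    refine ⟨b + a, ?_, h⟩
    have h0 := ((σ * τ) (origin F q ℓ)).2
    rw [h] at h0
    simpa [origin] using h0.symm
  inv_mem' := by
    rintro σ ⟨a, -, hσ⟩
    have h : ∀ P, (σ⁻¹ P).1 = (P.1.1 + -a, P.1.2) := fun P => by
      have h1 := hσ (σ⁻¹ P)
      rw [show σ (σ⁻¹ P) = P from σ.apply_symm_apply P] at h1
      rw [h1]
      simp
    refine ⟨-a, ?_, h⟩
    have h0 := (σ⁻¹ (origin F q ℓ)).2
    rw [h] at h0
    simpa [origin] using h0.symm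

/-- The group of scalings `(x, y) ↦ (x, c y)` with `c ^ (q ^ ℓ + 1) = 1`. -/
def scalingGroup (F : Type*) [Field F] (q ℓ : ℕ) :
    Subgroup (Equiv.Perm (Point F q ℓ)) where
  carrier := {σ | ∃ c : F, c ^ (q ^ ℓ + 1) = 1 ∧ ∀ P, (σ P).1 = (P.1.1, c * P.1.2)}
  one_mem' := ⟨1, by simp, fun P => by simp⟩
  mul_mem' := by
    rintro σ τ ⟨a, ha, hσ⟩ ⟨b, hb, hτ⟩
    exact ⟨a * b, by rw [mul_pow, ha, hb, one_mul], fun P => by simp [hσ, hτ, mul_assoc]⟩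
  inv_mem' := by
    rintro σ ⟨a, ha, hσ⟩
    refine ⟨a⁻¹, by rw [inv_pow, ha, inv_one], fun P => ?_⟩
    have ha0 : a ≠ 0 := by
      rintro rfl
      simp at ha
    have h1 := hσ (σ⁻¹ P)
    rw [show σ (σ⁻¹ P) = P from σ.apply_symm_apply P] at h1
    rw [h1]
    simp [ha0]

/-- The group generated by the translations and the scalings; it is their internal direct
product. -/
def fullGroup (F : Type*) [Field F] (q ℓ : ℕ) [NeZero q] :
    Subgroup (Equiv.Perm (Point F q ℓ)) :=
  translationGroup F q ℓ ⊔ scalingGroup F q ℓ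

/-- The evaluation points: the rational points with a long orbit under the full group,
i.e. those lying over the rational places of the fixed field that split completely. The
point at infinity is fixed by the group, so only affine points occur. -/
def EvalPoint (F : Type*) [Field F] (q ℓ : ℕ) [NeZero q] : Type _ :=
  {P : Point F q ℓ //
    (MulAction.orbit (fullGroup F q ℓ) P).ncard = Nat.card (fullGroup F q ℓ)}

noncomputable instance {F : Type*} [Field F] [Finite F] {q ℓ : ℕ} [NeZero q] :
    Fintype (EvalPoint F q ℓ) :=
  haveI : Finite (EvalPoint F q ℓ) := inferInstanceAs (Finite {P : Point F q ℓ //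
    (MulAction.orbit (fullGroup F q ℓ) P).ncard = Nat.card (fullGroup F q ℓ)})
  Fintype.ofFinite _

/-- The orbit of `P` under the group `H`, without `P` itself, as a set of coordinates. -/
def puncturedOrbit {F : Type*} [Field F] {q ℓ : ℕ} [NeZero q]
    (H : Subgroup (Equiv.Perm (Point F q ℓ))) (P : EvalPoint F q ℓ) : Set (EvalPoint F q ℓ) :=
  {Q | Q.1 ∈ MulAction.orbit H P.1 ∧ Q ≠ P}

/-- The space of the functions `∑_{i ≤ m₁} ∑_{j ≤ m₂} a_{i,j} x ^ j y ^ i`. -/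
noncomputable def functionSpace (F : Type*) [Field F] (q ℓ m₁ m₂ : ℕ) :
    Submodule F (CoordRing F q ℓ) :=
  Submodule.span F {f | ∃ i j : ℕ, i ≤ m₁ ∧ j ≤ m₂ ∧ f = x F q ℓ ^ j * y F q ℓ ^ i}

/-- The evaluation map `f ↦ (f(P))_P`, where `P` runs over the evaluation points. -/
noncomputable def evalMap (F : Type*) [Field F] (q ℓ : ℕ) [NeZero q] :
    CoordRing F q ℓ →ₗ[F] (EvalPoint F q ℓ → F) :=
  LinearMap.pi fun P => (evalAt P.1).toLinearMap

/-- The code of all the vectors `(f(P))_P` with `f` in the function space. -/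
noncomputable def evalCode (F : Type*) [Field F] (q ℓ m₁ m₂ : ℕ) [NeZero q] :
    Submodule F (EvalPoint F q ℓ → F) :=
  (functionSpace F q ℓ m₁ m₂).map (evalMap F q ℓ)

end GenHermitian

/-! ## Zeros of functions on the curve `y ^ w = x ^ q + x` -/

namespace WeightedCurve

open Polynomial

/-! Write w = q^ℓ + 1. A point with y = 0 is fixed by y ↦ -y, while a point with y ≠ 0 has trivial
stabiliser, so the evaluation points are those with y ≠ 0 (`orbit_ncard_eq_iff`). Here y^w lies in
the subfield of order q^ℓ, on which x ↦ x^q + x is bijective because q and ℓ are odd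
(`exists_trace_eq`). Hence each y ≠ 0 carries one coset of the kernel, that is q points, and the
length is q(q^(2ℓ) - 1).

The orbits of H₁ and H₂ through P are the fibres of y and of x, so they meet only in P. On them a
codeword is a polynomial in x of degree at most q - 2, resp. in y of degree at most q^ℓ - 1, and
Lagrange interpolation recovers its value at P from the other q - 1, resp. q^ℓ, points. For the
dimension, the points with y^w = 1 contain a q × w grid, on which the monomials are independent by
Vandermonde in each variable.

For the distance, give x weight w and y weight q. A function of weight at most s has norm to F[x] of
degree at most s (`natDegree_norm_le`). If it is nonzero, this degree is the dimension of the
coordinate ring modulo the function, and its rational zeros give linearly independent characters of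
that quotient. So there are at most s zeros (`card_zeros_le`). -/

/-- A bivariate polynomial, with inner variable `X` of weight `w` and outer variable `Y` of
weight `q`, has weighted degree at most `s`. -/
def WeightLE {F : Type*} [Field F] (q w : ℕ) (p : F[X][X]) (s : ℕ) : Prop :=
  ∀ i n, (p.coeff i).coeff n ≠ 0 → w * n + q * i ≤ s

/-- The curve polynomial `Y ^ w - (X ^ q + X)`, as a polynomial in `Y` over `F[X]`. -/
noncomputable def curve (F : Type*) [Field F] (q w : ℕ) : F[X][X] :=
  X ^ w - C (X ^ q + X)

variable {F : Type*} [Field F] {q w : ℕ}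

theorem WeightLE.sub {p r : F[X][X]} {s : ℕ} (hp : WeightLE q w p s) (hr : WeightLE q w r s) :
    WeightLE q w (p - r) s := by
  intro i n h
  by_cases h1 : (p.coeff i).coeff n = 0
  · refine hr i n fun h2 => h ?_
    simp [h1, h2]
  · exact hp i n h1

theorem WeightLE.add {p r : F[X][X]} {s : ℕ} (hp : WeightLE q w p s) (hr : WeightLE q w r s) :
    WeightLE q w (p + r) s := by
  intro i n h
  by_cases h1 : (p.coeff i).coeff n = 0
  · refine hr i n fun h2 => h ?_
    simp [h1, h2]
  · exact hp i n h1

theorem WeightLE.mul {p r : F[X][X]} {s t : ℕ} (hp : WeightLE q w p s)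
    (hr : WeightLE q w r t) : WeightLE q w (p * r) (s + t) := by
  intro i n h
  rw [coeff_mul, finsetSum_coeff] at h
  obtain ⟨⟨i₁, i₂⟩, hi, h⟩ := Finset.exists_ne_zero_of_sum_ne_zero h
  rw [coeff_mul] at h
  obtain ⟨⟨n₁, n₂⟩, hn, h⟩ := Finset.exists_ne_zero_of_sum_ne_zero h
  replace hi := Finset.HasAntidiagonal.mem_antidiagonal.1 hi
  replace hn := Finset.HasAntidiagonal.mem_antidiagonal.1 hn
  have h1 := hp i₁ n₁ (left_ne_zero_of_mul h)
  have h2 := hr i₂ n₂ (right_ne_zero_of_mul h)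
  simp only at hi hn
  subst hi hn
  linarith

theorem WeightLE.sum {κ : Type*} {t : Finset κ} {f : κ → F[X][X]} {s : ℕ}
    (h : ∀ k ∈ t, WeightLE q w (f k) s) : WeightLE q w (∑ k ∈ t, f k) s := by
  intro i n hn
  rw [finsetSum_coeff, finsetSum_coeff] at hn
  obtain ⟨k, hk, hn⟩ := Finset.exists_ne_zero_of_sum_ne_zero hn
  exact h k hk i n hn

theorem WeightLE.mono {p : F[X][X]} {s t : ℕ} (hp : WeightLE q w p s) (h : s ≤ t) :
    WeightLE q w p t := fun i n hn => (hp i n hn).trans h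

theorem weightLE_C_mul_X_pow {c : F[X]} {k s : ℕ}
    (h : ∀ n, c.coeff n ≠ 0 → w * n + q * k ≤ s) : WeightLE q w (C c * X ^ k) s := by
  intro i n hn
  rw [coeff_C_mul_X_pow] at hn
  split_ifs at hn with hi
  · exact hi ▸ h n hn
  · simp at hn

theorem weightLE_monomial (a : F) (j i : ℕ) :
    WeightLE q w (C (C a * X ^ j) * X ^ i) (w * j + q * i) := by
  refine weightLE_C_mul_X_pow fun n hn => ?_
  rw [coeff_C_mul_X_pow] at hn
  split_ifs at hn with h
  · rw [h]
  · simp at hn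

theorem weightLE_curve (hq : 1 ≤ q) : WeightLE q w (curve F q w) (q * w) := by
  have h1 : WeightLE q w (X ^ w : F[X][X]) (q * w) := by
    simpa using weightLE_monomial (q := q) (w := w) (1 : F) 0 w
  have h2 : WeightLE q w (C (X ^ q + X) : F[X][X]) (q * w) := by
    have h3 := weightLE_monomial (q := q) (w := w) (1 : F) q 0
    have h4 := weightLE_monomial (q := q) (w := w) (1 : F) 1 0
    have h5 := (h3.mono (t := q * w) (by simp [mul_comm])).add
      (h4.mono (t := q * w) (by simpa using Nat.le_mul_of_pos_left w hq))
    simpa using h5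
  exact h1.sub h2

theorem curve_monic (hw : w ≠ 0) : (curve F q w).Monic :=
  monic_X_pow_sub_C _ hw

theorem natDegree_curve : (curve F q w).natDegree = w :=
  natDegree_X_pow_sub_C

/-- Eisenstein at the prime X of F[X]: since q ≥ 2, X divides X^q + X exactly once. -/
theorem curve_irreducible (hq : 2 ≤ q) (hw : w ≠ 0) : Irreducible (curve F q w) := by
  have hlt : ∀ n : ℕ, (n : WithBot ℕ) < (curve F q w).degree → n < w := fun n hn => by
    rw [degree_eq_natDegree (curve_monic hw).ne_zero, natDegree_curve] at hn
    exact_mod_cast hn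
  refine irreducible_of_eisenstein_criterion (P := Ideal.span {(X : F[X])})
    ((Ideal.span_singleton_prime X_ne_zero).2 prime_X) ?_ ?_ ?_ ?_ (curve_monic hw).isPrimitive
  · rw [(curve_monic hw).leadingCoeff, ← Ideal.eq_top_iff_one, Ideal.span_singleton_eq_top]
    exact prime_X.not_isUnit
  · intro n hn
    have hn := hlt n hn
    rw [Ideal.mem_span_singleton, X_dvd_iff, curve, coeff_sub, coeff_X_pow, if_neg hn.ne,
      coeff_C]
    split_ifs <;> simp [coeff_X_pow, show ¬ 0 = q by omega]
  · rw [← natDegree_pos_iff_degree_pos, natDegree_curve]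
    omega
  · rw [Ideal.span_singleton_pow, Ideal.mem_span_singleton, X_pow_dvd_iff]
    intro h
    have := h 1 (by norm_num)
    rw [curve, coeff_sub, coeff_X_pow, if_neg hw.symm, coeff_C_zero] at this
    simp [coeff_X_pow, show (1 : ℕ) ≠ q by omega] at this

theorem isDomain_adjoinRoot (hq : 2 ≤ q) (hw : w ≠ 0) :
    IsDomain (AdjoinRoot (curve F q w)) :=
  AdjoinRoot.isDomain_of_prime (curve_irreducible hq hw).prime

/-- Each division step trades Y^w, of weight q * w, for X^q + X, of weight at most q * w, so no
weight is gained. -/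
theorem WeightLE.modByMonic (hq : 1 ≤ q) (hw : w ≠ 0) {s : ℕ} (p : F[X][X])
    (hp : WeightLE q w p s) : WeightLE q w (p %ₘ curve F q w) s := by
  induction hd : p.degree using WellFoundedLT.induction generalizing p with
  | ind d ih =>
  subst hd
  by_cases hlt : p.degree < (curve F q w).degree
  · rwa [(modByMonic_eq_self_iff (curve_monic hw)).2 hlt]
  rw [not_lt] at hlt
  by_cases hp0 : p = 0
  · simpa [hp0] using hp
  have hdeg := div_wf_lemma ⟨hlt, hp0⟩ (curve_monic hw)
  have hmod : (p - curve F q w * (C p.leadingCoeff * X ^ (p.natDegree - (curve F q w).natDegree)))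
      %ₘ curve F q w = p %ₘ curve F q w := by
    rw [sub_modByMonic, self_mul_modByMonic (curve_monic hw), sub_zero]
  rw [← hmod]
  refine ih _ hdeg _ ?_ rfl
  have hwd : w ≤ p.natDegree := by
    have := natDegree_le_natDegree hlt
    rwa [natDegree_curve] at this
  -- The leading term has Y-degree at least w, so `s - q * w` below is a genuine subtraction.
  have hs : q * w ≤ s := by
    have h0 : p.leadingCoeff ≠ 0 := leadingCoeff_ne_zero.2 hp0
    have := hp p.natDegree p.leadingCoeff.natDegree (leadingCoeff_ne_zero.2 h0)
    have := Nat.mul_le_mul_left q hwd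
    omega
  refine hp.sub ?_
  have h1 : WeightLE q w
      (C p.leadingCoeff * X ^ (p.natDegree - (curve F q w).natDegree)) (s - q * w) := by
    refine weightLE_C_mul_X_pow fun n hn => ?_
    have := hp p.natDegree n hn
    rw [natDegree_curve, Nat.mul_sub]
    have := Nat.mul_le_mul_left q hwd
    omega
  exact ((weightLE_curve hq).mul h1).mono (by omega)

/-- In each nonzero Leibniz term the shifts `d` cancel, because a permutation only rearranges them;
what remains is w times the degree, at most w * s. -/
theorem natDegree_det_le {n : Type*} [Fintype n] [DecidableEq n] (A : Matrix n n F[X])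
    (d : n → ℕ) (s : ℕ) (hw : w ≠ 0) (hn : Fintype.card n = w)
    (hA : ∀ i j, A i j ≠ 0 → w * (A i j).natDegree + d i ≤ s + d j) :
    A.det.natDegree ≤ s := by
  rw [Matrix.det_apply]
  refine natDegree_sum_le_of_forall_le _ _ fun σ _ => ?_
  refine (natDegree_smul_le _ _).trans ?_
  by_cases h0 : ∃ i, A (σ i) i = 0
  · obtain ⟨i, hi⟩ := h0
    have h1 : ∏ i, A (σ i) i = 0 := Finset.prod_eq_zero (Finset.mem_univ i) hi
    simp [h1]
  push Not at h0
  rw [natDegree_prod _ _ fun i _ => h0 i]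
  have h1 : ∑ i, (w * (A (σ i) i).natDegree + d (σ i)) ≤ ∑ i, (s + d i) :=
    Finset.sum_le_sum fun i _ => hA _ _ (h0 i)
  rw [Finset.sum_add_distrib, Finset.sum_add_distrib, Equiv.sum_comp σ d, ← Finset.mul_sum,
    Finset.sum_const, Finset.card_univ, hn, smul_eq_mul] at h1
  exact Nat.le_of_mul_le_mul_left (Nat.le_of_add_le_add_right h1) (Nat.pos_of_ne_zero hw)

theorem natDegree_norm_le_of_basis {S n : Type*} [CommRing S] [Algebra F[X] S] [Fintype n]
    [DecidableEq n] (b : Module.Basis n F[X] S) (f : S) (d : n → ℕ) (s : ℕ) (hw : w ≠ 0)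
    (hn : Fintype.card n = w)
    (hA : ∀ i j, Algebra.leftMulMatrix b f i j ≠ 0 →
      w * (Algebra.leftMulMatrix b f i j).natDegree + d i ≤ s + d j) :
    (Algebra.norm F[X] f).natDegree ≤ s := by
  rw [Algebra.norm_eq_matrix_det b]
  exact natDegree_det_le _ d s hw hn hA

theorem leftMulMatrix_powerBasisAux' {R : Type*} [CommRing R] {g : R[X]} (hg : g.Monic) (p : R[X])
    (i j : Fin g.natDegree) :
    Algebra.leftMulMatrix (AdjoinRoot.powerBasisAux' hg) (AdjoinRoot.mk g p) i j =
      ((p * X ^ (j : ℕ)) %ₘ g).coeff i := by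
  have hj : AdjoinRoot.powerBasisAux' hg j = AdjoinRoot.mk g (X ^ (j : ℕ)) := by
    rw [map_pow, AdjoinRoot.mk_X]
    exact (AdjoinRoot.powerBasis' hg).basis_eq_pow j
  rw [Algebra.leftMulMatrix_eq_repr_mul, hj, ← map_mul,
    AdjoinRoot.powerBasisAux'_repr_apply_to_fun, AdjoinRoot.modByMonicHom_mk]

/-- In the basis 1, Y, …, Y^(w-1), column j of multiplication by p is the reduction of p * Y^j, of
weight at most s + q * j. This is the determinant bound with shifts q * i. -/
theorem natDegree_norm_le (hq : 1 ≤ q) (hw : w ≠ 0) {s : ℕ} {p : F[X][X]}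
    (hp : WeightLE q w p s) :
    (Algebra.norm F[X] (AdjoinRoot.mk (curve F q w) p)).natDegree ≤ s := by
  refine natDegree_norm_le_of_basis (AdjoinRoot.powerBasisAux' (curve_monic (q := q) hw)) _
    (fun i => q * i) s hw ?_ ?_
  · exact (Fintype.card_fin _).trans natDegree_curve
  · intro i j hij
    rw [leftMulMatrix_powerBasisAux' (curve_monic (q := q) hw)] at hij ⊢
    have hX : WeightLE q w (X ^ (j : ℕ) : F[X][X]) (q * j) := by
      simpa using weightLE_monomial (q := q) (w := w) (1 : F) 0 (j : ℕ)
    exact (hp.mul hX).modByMonic hq hw _ i _ (leadingCoeff_ne_zero.2 hij)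

/-- Evaluation at an affine point of the curve. -/
noncomputable def evalPoint (a b : F) (h : b ^ w = a ^ q + a) :
    AdjoinRoot (curve F q w) →ₐ[F] F :=
  AdjoinRoot.liftAlgHom (curve F q w) (aeval a) b (by
    rw [curve, eval₂_sub, eval₂_X_pow, eval₂_C, h]
    simp)

theorem evalPoint_mk (a b : F) (h : b ^ w = a ^ q + a) (p : F[X][X]) :
    evalPoint a b h (AdjoinRoot.mk _ p) = p.evalEval a b := by
  rw [evalPoint, AdjoinRoot.liftAlgHom_mk]
  rw [← eval₂_evalRingHom]
  rfl

/-- Smith normal form over F[X] splits the quotient into finitely many cyclic pieces. Finiteness is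
what lets an independent family be counted by `finrank`. -/
theorem finiteDimensional_quotient {S ι : Type*} [CommRing S] [IsDomain S] [Algebra F[X] S]
    [Algebra F S] [IsScalarTower F F[X] S] [Finite ι] (b : Module.Basis ι F[X] S) {I : Ideal S}
    (hI : I ≠ ⊥) : FiniteDimensional F (S ⧸ I) := by
  have := Fintype.ofFinite ι
  have (i : ι) : FiniteDimensional F (F[X] ⧸ Ideal.span ({I.smithCoeffs b hI i} : Set F[X])) :=
    inferInstance
  exact Module.Finite.equiv (Ideal.quotientEquivDirectSum F b hI).symm

/-- A function of weighted degree at most `s` that does not vanish identically on the curve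
`y ^ w = x ^ q + x` has at most `s` affine rational zeros. -/
theorem card_zeros_le (hq : 2 ≤ q) (hw : w ≠ 0) {s : ℕ} {p : F[X][X]} (hp : WeightLE q w p s)
    (hne : ∃ a b : F, b ^ w = a ^ q + a ∧ p.evalEval a b ≠ 0) (T : Finset (F × F))
    (hT : ∀ P ∈ T, P.2 ^ w = P.1 ^ q + P.1 ∧ p.evalEval P.1 P.2 = 0) : T.card ≤ s := by
  have := isDomain_adjoinRoot (F := F) hq hw
  set f := AdjoinRoot.mk (curve F q w) p with hf
  have hf0 : f ≠ 0 := by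
    obtain ⟨a, b, h, h0⟩ := hne
    rintro h1
    rw [← evalPoint_mk a b h, ← hf, h1, map_zero] at h0
    exact h0 rfl
  let b := AdjoinRoot.powerBasisAux' (curve_monic (F := F) (q := q) hw)
  have hfin := finrank_quotient_span_eq_natDegree_norm (F := F) b hf0
  have hspan : Ideal.span {f} ≠ ⊥ := by simpa using hf0
  have := finiteDimensional_quotient (F := F) b hspan
  -- Evaluation at a zero of f factors through the quotient by f.
  let φ : T → (AdjoinRoot (curve F q w) ⧸ Ideal.span {f}) →ₐ[F] F := fun P =>
    Ideal.Quotient.liftₐ _ (evalPoint P.1.1 P.1.2 (hT P.1 P.2).1) (by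
      intro x hx
      obtain ⟨y, rfl⟩ := Ideal.mem_span_singleton'.1 hx
      rw [map_mul, hf, evalPoint_mk]
      exact mul_eq_zero_of_right _ (hT P.1 P.2).2)
  have hφ : ∀ P r, φ P (Ideal.Quotient.mk _ (AdjoinRoot.mk _ r)) = r.evalEval P.1.1 P.1.2 := by
    intro P r
    rw [← evalPoint_mk P.1.1 P.1.2 (hT P.1 P.2).1]
    rfl
  have hinj : Function.Injective φ := by
    intro P Q h
    have h1 := hφ P (C X)
    have h2 := hφ P X
    rw [h, hφ] at h1 h2
    simp only [evalEval_C, evalEval_X, eval_X] at h1 h2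
    exact Subtype.ext (Prod.ext h1.symm h2.symm)
  -- Dedekind: distinct characters are linearly independent.
  have hli := (linearIndependent_toLinearMap F
    (AdjoinRoot (curve F q w) ⧸ Ideal.span {f}) F).comp φ hinj
  have hcard := hli.fintype_card_le_finrank
  rw [Module.finrank_linearMap, Module.finrank_self, mul_one, Fintype.card_coe] at hcard
  exact hcard.trans (hfin.le.trans (natDegree_norm_le (by omega) hw hp))

end WeightedCurve

/-! ## Counting in the field with `q ^ (2 * ℓ)` elements -/

namespace GenHermitian

section Counting

variable {F : Type*} [Field F] [Fintype F] {q ℓ : ℕ}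

/-- The characteristic divides q^(2ℓ), so it is the prime below q and x ↦ x^q is an iterate of
Frobenius. -/
theorem add_pow_of_card (hq : IsPrimePow q) (hF : Fintype.card F = q ^ (2 * ℓ))
    (a b : F) : (a + b) ^ q = a ^ q + b ^ q := by
  obtain ⟨p, k, hp, hk, rfl⟩ := hq
  have hp := hp.nat_prime
  obtain ⟨p', hchar⟩ := CharP.exists F
  obtain ⟨n, hp', hn⟩ := FiniteField.card F p'
  have hdvd : p' ∣ p ^ k ^ 1 := by
    rw [hF] at hn
    have h1 : p' ∣ (p ^ k) ^ (2 * ℓ) := hn ▸ dvd_pow_self _ n.ne_zero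
    simpa using hp'.dvd_of_dvd_pow h1
  have : p' = p := (Nat.prime_dvd_prime_iff_eq hp' hp).1 (hp'.dvd_of_dvd_pow hdvd)
  subst this
  have := Fact.mk hp
  exact add_pow_char_pow a b p' k

theorem neg_one_ne_one_of_card (hq_odd : Odd q) (hF : Fintype.card F = q ^ (2 * ℓ)) :
    (-1 : F) ≠ 1 := by
  have h : ringChar F ≠ 2 := by
    intro h
    have := FiniteField.even_card_of_char_two h
    rw [hF] at this
    have := Nat.odd_iff.1 (hq_odd.pow (n := 2 * ℓ))
    omega
  exact Ring.neg_one_ne_one_of_char_ne_two h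

theorem exists_isPrimitiveRoot_of_dvd {d : ℕ} (hd : d ∣ Fintype.card F - 1) :
    ∃ ζ : F, IsPrimitiveRoot ζ d := by
  obtain ⟨g, hg⟩ := IsCyclic.exists_ofOrder_eq_natCard (α := Fˣ)
  have hN : Nat.card Fˣ = Fintype.card F - 1 := by
    rw [Nat.card_units, Nat.card_eq_fintype_card]
  obtain ⟨e, he⟩ := hd
  have hprim : IsPrimitiveRoot (g : F) (Fintype.card F - 1) := by
    rw [IsPrimitiveRoot.coe_units_iff, ← hN, ← hg]
    exact IsPrimitiveRoot.orderOf g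
  have hpos : 0 < Fintype.card F - 1 := by
    have := Fintype.one_lt_card (α := F)
    omega
  exact ⟨_, hprim.pow hpos (he.trans (mul_comm _ _))⟩

theorem card_pow_eq_one {d : ℕ} (hd0 : 0 < d) (hd : d ∣ Fintype.card F - 1) :
    Nat.card {c : F // c ^ d = 1} = d := by
  obtain ⟨ζ, hζ⟩ := exists_isPrimitiveRoot_of_dvd hd
  classical
  exact (Nat.subtype_card (Polynomial.nthRootsFinset d (1 : F)) fun x =>
    Polynomial.mem_nthRootsFinset hd0 _).trans hζ.card_nthRootsFinset

/-- The factor 2 comes from q + 1 being even. It makes -1 a (q - 1)-th power in F. -/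
theorem two_mul_sub_one_dvd (hq_odd : Odd q) :
    2 * (q - 1) ∣ q ^ (2 * ℓ) - 1 := by
  have h1 : q ^ 2 - 1 ∣ q ^ (2 * ℓ) - 1 := by
    rw [pow_mul]
    simpa using Nat.sub_dvd_pow_sub_pow (q ^ 2) 1 ℓ
  refine Dvd.dvd.trans ?_ h1
  have h2 : q ^ 2 - 1 = (q + 1) * (q - 1) := by
    simpa using Nat.sq_sub_sq q 1
  rw [h2]
  exact Nat.mul_dvd_mul_right hq_odd.add_one.two_dvd _

theorem pow_add_one_dvd : q ^ ℓ + 1 ∣ q ^ (2 * ℓ) - 1 := by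
  have h2 : q ^ (2 * ℓ) - 1 = (q ^ ℓ + 1) * (q ^ ℓ - 1) := by
    rw [mul_comm 2 ℓ, pow_mul]
    simpa using Nat.sq_sub_sq (q ^ ℓ) 1
  exact Dvd.intro _ h2.symm

/-- The nonzero solutions satisfy a^(q-1) = -1. They form the coset of the (q - 1)-th roots of unity
through a primitive 2(q - 1)-th root ζ. -/
theorem card_translations (hq2 : 2 ≤ q) (hq_odd : Odd q) (hF : Fintype.card F = q ^ (2 * ℓ)) :
    Nat.card {a : F // a ^ q + a = 0} = q := by
  classical
  obtain ⟨ζ, hζ⟩ := exists_isPrimitiveRoot_of_dvd (F := F) (d := 2 * (q - 1))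
    (hF ▸ two_mul_sub_one_dvd hq_odd)
  have hpos : 0 < 2 * (q - 1) := by omega
  have hζ0 : ζ ≠ 0 := hζ.ne_zero (by omega)
  have hζ1 : ζ ^ (q - 1) = -1 :=
    (hζ.pow hpos (mul_comm 2 (q - 1))).eq_neg_one_of_two_right
  have hprim : IsPrimitiveRoot (ζ ^ 2) (q - 1) := hζ.pow hpos rfl
  have hcard : (insert 0 ((Polynomial.nthRootsFinset (q - 1) (1 : F)).image (ζ * ·))).card
      = q := by
    rw [Finset.card_insert_of_notMem, Finset.card_image_of_injective _
      (mul_right_injective₀ hζ0), hprim.card_nthRootsFinset]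
    · omega
    · intro h
      obtain ⟨x, hx, hx0⟩ := Finset.mem_image.1 h
      rw [Polynomial.mem_nthRootsFinset (by omega)] at hx
      rcases mul_eq_zero.1 hx0 with h | h
      · exact hζ0 h
      · rw [h, zero_pow (by omega)] at hx
        exact zero_ne_one hx
  refine (Nat.subtype_card _ fun a => ?_).trans hcard
  have hfac : a ^ q + a = a * (a ^ (q - 1) + 1) := by
    rw [mul_add, mul_one, mul_pow_sub_one (by omega)]
  rw [Finset.mem_insert, Finset.mem_image, hfac, mul_eq_zero]
  refine or_congr_right ⟨?_, fun h => ⟨ζ⁻¹ * a, ?_, by simp [hζ0]⟩⟩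
  · rintro ⟨x, hx, rfl⟩
    rw [Polynomial.mem_nthRootsFinset (by omega)] at hx
    rw [mul_pow, hζ1, hx]
    ring
  · rw [Polynomial.mem_nthRootsFinset (by omega), mul_pow, inv_pow, hζ1,
      eq_neg_of_add_eq_zero_left h]
    simp

theorem card_scalings (hF : Fintype.card F = q ^ (2 * ℓ)) :
    Nat.card {c : F // c ^ (q ^ ℓ + 1) = 1} = q ^ ℓ + 1 :=
  card_pow_eq_one (Nat.succ_pos _) (hF ▸ pow_add_one_dvd)

/-- The map x ↦ x^q + x preserves the finite set of solutions of z^(q^ℓ) = z, so injectivity there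
gives surjectivity. -/
theorem exists_trace_eq (hq : IsPrimePow q) (hq_odd : Odd q) (hl_odd : Odd ℓ)
    (hF : Fintype.card F = q ^ (2 * ℓ)) {z : F} (hz : z ^ q ^ ℓ = z) :
    ∃ x : F, x ^ q + x = z := by
  have hadd := add_pow_of_card (F := F) hq hF
  have haddl : ∀ k (a b : F), (a + b) ^ q ^ k = a ^ q ^ k + b ^ q ^ k := by
    intro k
    induction k with
    | zero => simp
    | succ k ih =>
      intro a b
      rw [pow_succ, pow_mul, ih, hadd, pow_mul, pow_mul]
  let E := {z : F // z ^ q ^ ℓ = z}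
  let L : E → E := fun x => ⟨x.1 ^ q + x.1, by
    rw [haddl, ← pow_mul, mul_comm q, pow_mul, x.2]⟩
  have hL : Function.Injective L := by
    intro x y hxy
    have h1 : x.1 ^ q + x.1 = y.1 ^ q + y.1 := congrArg Subtype.val hxy
    have h2 : (x.1 - y.1) ^ q = -(x.1 - y.1) := by
      have h3 := hadd (x.1 - y.1) y.1
      rw [sub_add_cancel] at h3
      linear_combination h1 - h3
    -- Iterating d^q = -d gives d^(q^ℓ) = -d for odd ℓ, whereas d^(q^ℓ) = d in the subfield; so 2d =
    -- 0.
    have h4 : ∀ k, (x.1 - y.1) ^ q ^ k = (-1) ^ k * (x.1 - y.1) := by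
      intro k
      induction k with
      | zero => simp
      | succ k ih =>
        rw [pow_succ q, pow_mul, ih, mul_pow, h2, ← pow_mul, mul_comm k q, pow_mul,
          hq_odd.neg_one_pow]
        ring
    have h5 : (x.1 - y.1) ^ q ^ ℓ = x.1 - y.1 := by
      have h6 := haddl ℓ (x.1 - y.1) y.1
      rw [sub_add_cancel, x.2, y.2] at h6
      linear_combination -h6
    rw [h4, hl_odd.neg_one_pow] at h5
    have h7 : (-1 - 1 : F) * (x.1 - y.1) = 0 := by linear_combination h5
    rcases mul_eq_zero.1 h7 with h | h
    · exact absurd (sub_eq_zero.1 h) (neg_one_ne_one_of_card hq_odd hF)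
    · exact Subtype.ext (sub_eq_zero.1 h)
  obtain ⟨x, hx⟩ := Finite.surjective_of_injective hL ⟨z, hz⟩
  exact ⟨x.1, congrArg Subtype.val hx⟩

theorem exists_point_above (hq : IsPrimePow q) (hq_odd : Odd q) (hl_odd : Odd ℓ)
    (hF : Fintype.card F = q ^ (2 * ℓ)) (y : F) :
    ∃ x : F, y ^ (q ^ ℓ + 1) = x ^ q + x := by
  -- The norm y^(q^ℓ + 1) is fixed by z ↦ z^(q^ℓ), because y^(q^(2ℓ)) = y.
  obtain ⟨x, hx⟩ := exists_trace_eq hq hq_odd hl_odd hF (z := y ^ (q ^ ℓ + 1)) (by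
    have hy := FiniteField.pow_card y
    rw [hF] at hy
    rw [← pow_mul, add_mul, one_mul, ← pow_add, ← two_mul, pow_add, hy, pow_succ, mul_comm])
  exact ⟨x, hx.symm⟩

end Counting

end GenHermitian

/-! ## The groups and the long orbits -/

namespace GenHermitian

section Orbits

theorem ncard_orbit_eq_card_iff {G α : Type*} [Group G] [MulAction G α] [Finite G] (P : α) :
    (MulAction.orbit G P).ncard = Nat.card G ↔ Function.Injective fun g : G => g • P := by
  constructor
  · intro h
    have h1 : Function.Injective (Set.rangeFactorization fun g : G => g • P) := by
      refine ((Nat.bijective_iff_surjective_and_card _).2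
        ⟨Set.rangeFactorization_surjective, ?_⟩).1
      rw [Nat.card_coe_set_eq]
      exact h.symm
    intro g g' hg
    exact h1 (Subtype.ext hg)
  · exact fun h => Set.ncard_range_of_injective h

variable {F : Type*} [Field F] {q ℓ : ℕ}

/-- Scaling of a point. -/
def scale (c : F) (hc : c ^ (q ^ ℓ + 1) = 1) (P : Point F q ℓ) : Point F q ℓ :=
  ⟨(P.1.1, c * P.1.2), by rw [mul_pow, hc, one_mul, P.2]⟩

/-- Scaling as a permutation of the points. -/
def scalePerm (c : F) (hc : c ^ (q ^ ℓ + 1) = 1) : Equiv.Perm (Point F q ℓ) where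
  toFun := scale c hc
  invFun := scale c⁻¹ (by rw [inv_pow, hc, inv_one])
  left_inv P := Subtype.ext (by
    have : c ≠ 0 := by rintro rfl; simp at hc
    simp [scale, this])
  right_inv P := Subtype.ext (by
    have : c ≠ 0 := by rintro rfl; simp at hc
    simp [scale, this])

theorem scalePerm_mem (c : F) (hc : c ^ (q ^ ℓ + 1) = 1) :
    scalePerm (q := q) c hc ∈ scalingGroup F q ℓ :=
  ⟨c, hc, fun _ => rfl⟩

/-- A point with y ≠ 0 is needed for distinct scalars to give distinct permutations. -/
theorem card_scalingGroup (hpt : ∃ P : Point F q ℓ, P.1.2 ≠ 0) :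
    Nat.card (scalingGroup F q ℓ) = Nat.card {c : F // c ^ (q ^ ℓ + 1) = 1} := by
  obtain ⟨P, hP⟩ := hpt
  refine (Nat.card_congr (Equiv.ofBijective (fun c : {c : F // c ^ (q ^ ℓ + 1) = 1} =>
    (⟨scalePerm c.1 c.2, scalePerm_mem c.1 c.2⟩ : scalingGroup F q ℓ))
    ⟨fun a b h => ?_, ?_⟩)).symm
  · have h1 := congrArg (fun σ : scalingGroup F q ℓ => (σ.1 P).1.2) h
    exact Subtype.ext (mul_right_cancel₀ hP h1)
  · rintro ⟨σ, c, hc, hσ⟩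
    exact ⟨⟨c, hc⟩, Subtype.ext (Equiv.ext fun P => Subtype.ext (hσ P).symm)⟩

theorem mem_orbit_scalingGroup {P Q : Point F q ℓ} (hP : P.1.2 ≠ 0) :
    Q ∈ MulAction.orbit (scalingGroup F q ℓ) P ↔ Q.1.1 = P.1.1 := by
  constructor
  · rintro ⟨⟨σ, a, ha, hσ⟩, rfl⟩
    change (σ P).1.1 = P.1.1
    rw [hσ]
  · intro h
    have hc : (Q.1.2 / P.1.2) ^ (q ^ ℓ + 1) = 1 := by
      rw [div_pow, Q.2, h, ← P.2]
      exact div_self (pow_ne_zero _ hP)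
    exact ⟨⟨_, scalePerm_mem _ hc⟩, Subtype.ext (Prod.ext h.symm (div_mul_cancel₀ _ hP))⟩

variable [NeZero q]

/-- Translation of a point. -/
def translate (hadd : ∀ a b : F, (a + b) ^ q = a ^ q + b ^ q) (a : F) (ha : a ^ q + a = 0)
    (P : Point F q ℓ) : Point F q ℓ :=
  ⟨(P.1.1 + a, P.1.2), by
    have h := P.2
    rw [hadd]
    linear_combination h - ha⟩

/-- Translation as a permutation of the points. -/
def translatePerm (hadd : ∀ a b : F, (a + b) ^ q = a ^ q + b ^ q) (a : F)
    (ha : a ^ q + a = 0) : Equiv.Perm (Point F q ℓ) where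
  toFun := translate hadd a ha
  invFun := translate hadd (-a) (by
    have h := hadd a (-a)
    rw [add_neg_cancel, zero_pow (NeZero.ne q)] at h
    linear_combination -h - ha)
  left_inv P := Subtype.ext (by simp [translate])
  right_inv P := Subtype.ext (by simp [translate])

theorem translatePerm_mem (hadd : ∀ a b : F, (a + b) ^ q = a ^ q + b ^ q) (a : F)
    (ha : a ^ q + a = 0) : translatePerm hadd a ha ∈ translationGroup F q ℓ :=
  ⟨a, ha, fun _ => rfl⟩

theorem card_translationGroup (hadd : ∀ a b : F, (a + b) ^ q = a ^ q + b ^ q) :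
    Nat.card (translationGroup F q ℓ) = Nat.card {a : F // a ^ q + a = 0} := by
  refine (Nat.card_congr (Equiv.ofBijective (fun a : {a : F // a ^ q + a = 0} =>
    (⟨translatePerm hadd a.1 a.2, translatePerm_mem hadd a.1 a.2⟩ : translationGroup F q ℓ))
    ⟨fun a b h => ?_, ?_⟩)).symm
  · have h1 := congrArg (fun σ : translationGroup F q ℓ => (σ.1 (origin F q ℓ)).1.1) h
    exact Subtype.ext (add_left_cancel (a := (0 : F)) h1)
  · rintro ⟨σ, a, ha, hσ⟩
    exact ⟨⟨a, ha⟩, Subtype.ext (Equiv.ext fun P => Subtype.ext (hσ P).symm)⟩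

theorem mem_orbit_translationGroup (hadd : ∀ a b : F, (a + b) ^ q = a ^ q + b ^ q)
    {P Q : Point F q ℓ} : Q ∈ MulAction.orbit (translationGroup F q ℓ) P ↔ Q.1.2 = P.1.2 := by
  constructor
  · rintro ⟨⟨σ, a, ha, hσ⟩, rfl⟩
    change (σ P).1.2 = P.1.2
    rw [hσ]
  · intro h
    have ha : (Q.1.1 - P.1.1) ^ q + (Q.1.1 - P.1.1) = 0 := by
      have h1 := hadd (Q.1.1 - P.1.1) P.1.1
      rw [sub_add_cancel] at h1
      have h2 := Q.2
      rw [h] at h2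
      linear_combination P.2 - h2 - h1
    exact ⟨⟨_, translatePerm_mem hadd _ ha⟩, Subtype.ext (Prod.ext (add_sub_cancel _ _) h.symm)⟩

/-- Only this shape matters for stabilisers, so of the equations on a and c just c ≠ 0 is kept,
enough to invert. -/
theorem exists_of_mem_fullGroup {σ : Equiv.Perm (Point F q ℓ)} (hσ : σ ∈ fullGroup F q ℓ) :
    ∃ a c : F, c ≠ 0 ∧ ∀ P, (σ P).1 = (P.1.1 + a, c * P.1.2) := by
  rw [fullGroup, Subgroup.sup_eq_closure] at hσ
  induction hσ using Subgroup.closure_induction with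
  | mem σ h =>
    rcases h with ⟨a, -, h⟩ | ⟨c, hc, h⟩
    · exact ⟨a, 1, one_ne_zero, fun P => by simp [h]⟩
    · exact ⟨0, c, by rintro rfl; simp at hc, fun P => by simp [h]⟩
  | one => exact ⟨0, 1, one_ne_zero, fun P => by simp⟩
  | mul σ τ _ _ hσ hτ =>
    obtain ⟨a, c, hc, hσ⟩ := hσ
    obtain ⟨b, d, hd, hτ⟩ := hτ
    exact ⟨b + a, c * d, mul_ne_zero hc hd, fun P => by simp [hσ, hτ, add_assoc, mul_assoc]⟩
  | inv σ _ hσ =>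
    obtain ⟨a, c, hc, hσ⟩ := hσ
    refine ⟨-a, c⁻¹, inv_ne_zero hc, fun P => ?_⟩
    have h1 := hσ (σ⁻¹ P)
    rw [show σ (σ⁻¹ P) = P from σ.apply_symm_apply P] at h1
    rw [h1]
    simp [hc]

theorem orbit_ncard_eq_iff [Finite F] (hneg : (-1 : F) ≠ 1) (hodd : Odd q)
    (hpt : ∃ P : Point F q ℓ, P.1.2 ≠ 0) (P : Point F q ℓ) :
    (MulAction.orbit (fullGroup F q ℓ) P).ncard = Nat.card (fullGroup F q ℓ) ↔ P.1.2 ≠ 0 := by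
  rw [ncard_orbit_eq_card_iff]
  constructor
  · intro h hP
    obtain ⟨P₀, hP₀⟩ := hpt
    -- Since q is odd, y ↦ -y belongs to the scalings; it fixes P when y = 0 but moves P₀.
    have hc : (-1 : F) ^ (q ^ ℓ + 1) = 1 := (hodd.pow.add_one).neg_one_pow
    have hm : scalePerm (q := q) (-1) hc ∈ fullGroup F q ℓ :=
      (le_sup_right : scalingGroup F q ℓ ≤ fullGroup F q ℓ) (scalePerm_mem _ hc)
    have h1 : (⟨_, hm⟩ : fullGroup F q ℓ) = 1 :=
      h (Subtype.ext (Prod.ext (by rfl) (by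
        change -1 * P.1.2 = P.1.2
        simp [hP])))
    have h2 := congrArg (fun g : fullGroup F q ℓ => (g.1 P₀).1.2) h1
    change -1 * P₀.1.2 = P₀.1.2 at h2
    exact hneg (mul_right_cancel₀ hP₀ (h2.trans (one_mul _).symm))
  · rintro hP ⟨σ, hσ⟩ ⟨τ, hτ⟩ h
    obtain ⟨a, c, -, hσ'⟩ := exists_of_mem_fullGroup hσ
    obtain ⟨b, d, -, hτ'⟩ := exists_of_mem_fullGroup hτ
    have h1 : (σ P).1 = (τ P).1 := congrArg Subtype.val h
    rw [hσ', hτ', Prod.mk.injEq] at h1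
    have hab := add_left_cancel h1.1
    have hcd := mul_right_cancel₀ hP h1.2
    exact Subtype.ext (Equiv.ext fun Q => Subtype.ext (by rw [hσ', hτ', hab, hcd]))

theorem evalPoint_val_injective :
    Function.Injective fun P : EvalPoint F q ℓ => (P.1 : Point F q ℓ) :=
  Subtype.val_injective

theorem ncard_puncturedOrbit [Finite F] {H : Subgroup (Equiv.Perm (Point F q ℓ))}
    (hH : H ≤ fullGroup F q ℓ) (P : EvalPoint F q ℓ) :
    (puncturedOrbit H P).ncard = Nat.card H - 1 := by
  have himg : (fun Q : EvalPoint F q ℓ => (Q.1 : Point F q ℓ)) '' puncturedOrbit H P =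
      MulAction.orbit H P.1 \ {P.1} := by
    ext Q
    constructor
    · rintro ⟨Q, ⟨h1, h2⟩, rfl⟩
      exact ⟨h1, fun h => h2 (Subtype.ext h)⟩
    · rintro ⟨⟨g, rfl⟩, h2⟩
      -- Points in one full orbit are long together, so the H-orbit stays among the coordinates.
      have hfull : MulAction.orbit (fullGroup F q ℓ) (g • P.1) =
          MulAction.orbit (fullGroup F q ℓ) P.1 :=
        MulAction.orbit_eq_iff.2 ⟨⟨g.1, hH g.2⟩, rfl⟩
      exact ⟨⟨g • P.1, by rw [hfull]; exact P.2⟩,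
        ⟨⟨g, rfl⟩, fun h => h2 (congrArg Subtype.val h)⟩, rfl⟩
  have hcard : (MulAction.orbit H P.1).ncard = Nat.card H := by
    rw [ncard_orbit_eq_card_iff]
    intro g g' h
    have h1 : (⟨g.1, hH g.2⟩ : fullGroup F q ℓ) = ⟨g'.1, hH g'.2⟩ :=
      (ncard_orbit_eq_card_iff P.1).1 P.2 h
    exact Subtype.ext (congrArg (fun σ : fullGroup F q ℓ => σ.1) h1)
  rw [← Set.ncard_image_of_injective _ (evalPoint_val_injective (F := F)), himg,
    Set.ncard_sdiff_singleton_of_mem (MulAction.mem_orbit_self P.1), hcard]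

theorem card_evalPoint [Fintype F] (hneg : (-1 : F) ≠ 1) (hodd : Odd q)
    (habove : ∀ y : F, ∃ x : F, y ^ (q ^ ℓ + 1) = x ^ q + x)
    (hadd : ∀ a b : F, (a + b) ^ q = a ^ q + b ^ q) :
    Fintype.card (EvalPoint F q ℓ) =
      (Fintype.card F - 1) * Nat.card {a : F // a ^ q + a = 0} := by
  have hpt : ∃ P : Point F q ℓ, P.1.2 ≠ 0 := by
    obtain ⟨x, hx⟩ := habove 1
    exact ⟨⟨(x, 1), hx⟩, one_ne_zero⟩
  have hlong := orbit_ncard_eq_iff hneg hodd hpt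
  choose x₀ hx₀ using habove
  rw [← Nat.card_eq_fintype_card, ← Nat.card_eq_fintype_card, ← Nat.card_units, ← Nat.card_prod]
  -- Points are parametrised by y ≠ 0 and the offset of x from a chosen solution x₀ y.
  refine (Nat.card_congr (Equiv.ofBijective
    (fun u : Fˣ × {a : F // a ^ q + a = 0} =>
      (⟨translate hadd u.2.1 u.2.2 ⟨(x₀ u.1, u.1), hx₀ u.1⟩, (hlong _).2 u.1.ne_zero⟩ :
        EvalPoint F q ℓ)) ⟨fun u v h => ?_, fun P => ?_⟩)).symm
  · have h1 := congrArg (fun P : EvalPoint F q ℓ => P.1.1) h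
    have h2 : x₀ u.1 + u.2.1 = x₀ v.1 + v.2.1 := congrArg Prod.fst h1
    have h3 : u.1 = v.1 := Units.ext (congrArg Prod.snd h1)
    rw [h3] at h2
    exact Prod.ext h3 (Subtype.ext (add_left_cancel h2))
  · have hy := (hlong P.1).1 P.2
    let P₀ : Point F q ℓ := ⟨(x₀ P.1.1.2, P.1.1.2), hx₀ _⟩
    have hm : P.1 ∈ MulAction.orbit (translationGroup F q ℓ) P₀ :=
      (mem_orbit_translationGroup hadd).2 rfl
    obtain ⟨⟨σ, a, ha, hσ⟩, hσP⟩ := hm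
    refine ⟨(Units.mk0 _ hy, ⟨a, ha⟩), Subtype.ext (Subtype.ext ?_)⟩
    have h1 := congrArg Subtype.val hσP
    exact (hσ _).symm.trans h1

end Orbits

end GenHermitian

/-! ## Repair sets, dimension and minimum distance -/

section Codes

variable {F ι : Type*} [Field F]

/-- The Lagrange coefficients at `g i` do not depend on the codeword, so one linear relation holds
for all rows and hence between columns. -/
theorem isRepairSet_of_polynomial [Finite ι] {C : Submodule F (ι → F)} {i : ι} {R : Set ι}
    (hi : i ∉ R) (g : ι → F) (hg : Set.InjOn g R) {d : ℕ} (hd : d < R.ncard)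
    (h : ∀ c ∈ C, ∃ p : Polynomial F, p.natDegree ≤ d ∧
      ∀ j ∈ insert i R, c j = p.eval (g j)) : IsRepairSet C i R := by
  classical
  refine ⟨hi, fun k G hG => ?_⟩
  set s : Finset ι := R.toFinite.toFinset with hs
  have hmem : ∀ j, j ∈ s ↔ j ∈ R := fun j => Set.Finite.mem_toFinset _
  have hcard : R.ncard = s.card := Set.ncard_eq_toFinset_card R
  have key : ∀ c ∈ C, c i = ∑ j ∈ s, (Lagrange.basis s g j).eval (g i) * c j := by
    intro c hc
    obtain ⟨p, hp, hpc⟩ := h c hc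
    have hp' : p.degree < s.card := by
      refine Polynomial.degree_le_natDegree.trans_lt ?_
      exact_mod_cast hp.trans_lt (hcard ▸ hd)
    have hs' : Set.InjOn g s := by
      intro a ha b hb hab
      exact hg ((hmem a).1 ha) ((hmem b).1 hb) hab
    have hint := Lagrange.eq_interpolate_of_eval_eq c hs' hp' fun j hj =>
      (hpc j (Or.inr ((hmem j).1 hj))).symm
    rw [hpc i (Or.inl rfl), hint, Lagrange.interpolate_apply, Polynomial.eval_finsetSum]
    refine Finset.sum_congr rfl fun j _ => ?_
    rw [Polynomial.eval_mul, Polynomial.eval_C, mul_comm]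
  have hcol : G.col i = ∑ j ∈ s, (Lagrange.basis s g j).eval (g i) • G.col j := by
    ext r
    have hr : G.row r ∈ C := hG.2 ▸ Submodule.subset_span ⟨r, rfl⟩
    have := key _ hr
    simpa [Finset.sum_apply] using this
  rw [hcol]
  exact Submodule.sum_mem _ fun j hj =>
    Submodule.smul_mem _ _ (Submodule.subset_span ⟨j, (hmem j).1 hj, rfl⟩)

theorem le_minDist [DecidableEq F] [Fintype ι] {C : Submodule F (ι → F)} {d : ℕ} (hC : C ≠ ⊥)
    (h : ∀ c ∈ C, c ≠ 0 → d ≤ hammingNorm c) : d ≤ minDist C := by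
  obtain ⟨c, hc, hc0⟩ := C.ne_bot_iff.1 hC
  -- A nonzero codeword is required: the infimum of the empty set would be 0.
  refine le_csInf ⟨_, c, hc, 0, C.zero_mem, hc0, rfl⟩ ?_
  rintro _ ⟨u, hu, v, hv, huv, rfl⟩
  rw [hammingDist_eq_hammingNorm, neg_add_eq_sub]
  exact h _ (C.sub_mem hv hu) (sub_ne_zero.2 huv.symm)

theorem eq_zero_of_sum_mul_pow_eq_zero {A : Type*} [Finite A] {f : A → F}
    (hf : Function.Injective f) {n : ℕ} (hn : n ≤ Nat.card A) {v : Fin n → F}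
    (h : ∀ a, ∑ i, v i * f a ^ (i : ℕ) = 0) : v = 0 := by
  have := Fintype.ofFinite A
  obtain ⟨e⟩ : Nonempty (Fin n ↪ A) := Function.Embedding.nonempty_of_card_le (by
    rwa [Fintype.card_fin, ← Nat.card_eq_fintype_card])
  refine Matrix.eq_zero_of_forall_index_sum_pow_mul_eq_zero (f := f ∘ e)
    (hf.comp e.injective) fun j => ?_
  simpa [mul_comm] using h (e j)

end Codes

/-! ### The evaluation code: codewords as polynomials in x and y -/

namespace GenHermitian

section EvalCode

variable {F : Type*} [Field F] {q ℓ : ℕ} [NeZero q]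

/-- The vector of values of the function `x ^ j y ^ i` at the evaluation points. -/
def monomialVec (F : Type*) [Field F] (q ℓ : ℕ) [NeZero q] {m₁ m₂ : ℕ}
    (k : Fin (m₁ + 1) × Fin (m₂ + 1)) : EvalPoint F q ℓ → F :=
  fun P => P.1.1.1 ^ (k.2 : ℕ) * P.1.1.2 ^ (k.1 : ℕ)

theorem evalCode_eq_span (m₁ m₂ : ℕ) : evalCode F q ℓ m₁ m₂ =
    Submodule.span F (Set.range (monomialVec F q ℓ (m₁ := m₁) (m₂ := m₂))) := by
  have hev : ∀ i j : ℕ, evalMap F q ℓ (x F q ℓ ^ j * y F q ℓ ^ i) =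
      fun P => P.1.1.1 ^ j * P.1.1.2 ^ i := by
    intro i j
    ext P
    simp [evalMap, evalAt_x, evalAt_y]
  rw [evalCode, functionSpace, Submodule.map_span]
  congr 1
  ext c
  constructor
  · rintro ⟨_, ⟨i, j, hi, hj, rfl⟩, rfl⟩
    exact ⟨(⟨i, by omega⟩, ⟨j, by omega⟩), (hev i j).symm⟩
  · rintro ⟨⟨i, j⟩, rfl⟩
    exact ⟨_, ⟨i, j, by omega, by omega, rfl⟩, hev i j⟩

theorem exists_coeff_of_mem_evalCode {m₁ m₂ : ℕ} {c : EvalPoint F q ℓ → F}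
    (hc : c ∈ evalCode F q ℓ m₁ m₂) : ∃ a : Fin (m₁ + 1) × Fin (m₂ + 1) → F,
      ∀ P, c P = ∑ k, a k * (P.1.1.1 ^ (k.2 : ℕ) * P.1.1.2 ^ (k.1 : ℕ)) := by
  rw [evalCode_eq_span, Submodule.mem_span_range_iff_exists_fun] at hc
  obtain ⟨a, rfl⟩ := hc
  exact ⟨a, fun P => by simp [monomialVec]⟩

theorem isRepairSet_translation [Finite F] (hadd : ∀ a b : F, (a + b) ^ q = a ^ q + b ^ q)
    {m₁ m₂ : ℕ} (hm : m₂ + 1 < Nat.card (translationGroup F q ℓ)) (P : EvalPoint F q ℓ) :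
    IsRepairSet (evalCode F q ℓ m₁ m₂) P (puncturedOrbit (translationGroup F q ℓ) P) := by
  refine isRepairSet_of_polynomial (fun h => h.2 rfl) (fun Q => Q.1.1.1) ?_ (d := m₂) ?_ ?_
  · intro Q hQ R hR h
    have hy := ((mem_orbit_translationGroup hadd).1 hQ.1).trans
      ((mem_orbit_translationGroup hadd).1 hR.1).symm
    exact Subtype.ext (Subtype.ext (Prod.ext h hy))
  · rw [ncard_puncturedOrbit le_sup_left]
    omega
  · intro c hc
    obtain ⟨a, ha⟩ := exists_coeff_of_mem_evalCode hc
    refine ⟨∑ k, Polynomial.C (a k * P.1.1.2 ^ (k.1 : ℕ)) * Polynomial.X ^ (k.2 : ℕ),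
      Polynomial.natDegree_sum_le_of_forall_le _ _ fun k _ =>
        (Polynomial.natDegree_C_mul_X_pow_le _ _).trans (by omega), fun Q hQ => ?_⟩
    have hy : Q.1.1.2 = P.1.1.2 := by
      rcases hQ with rfl | hQ
      · rfl
      · exact (mem_orbit_translationGroup hadd).1 hQ.1
    rw [ha, Polynomial.eval_finsetSum]
    refine Finset.sum_congr rfl fun k _ => ?_
    rw [hy]
    simp
    ring

theorem isRepairSet_scaling [Finite F] (hy : ∀ P : EvalPoint F q ℓ, P.1.1.2 ≠ 0)
    {m₁ m₂ : ℕ} (hm : m₁ + 1 < Nat.card (scalingGroup F q ℓ)) (P : EvalPoint F q ℓ) :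
    IsRepairSet (evalCode F q ℓ m₁ m₂) P (puncturedOrbit (scalingGroup F q ℓ) P) := by
  refine isRepairSet_of_polynomial (fun h => h.2 rfl) (fun Q => Q.1.1.2) ?_ (d := m₁) ?_ ?_
  · intro Q hQ R hR h
    have hx := ((mem_orbit_scalingGroup (hy P)).1 hQ.1).trans
      ((mem_orbit_scalingGroup (hy P)).1 hR.1).symm
    exact Subtype.ext (Subtype.ext (Prod.ext hx h))
  · rw [ncard_puncturedOrbit le_sup_right]
    omega
  · intro c hc
    obtain ⟨a, ha⟩ := exists_coeff_of_mem_evalCode hc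
    refine ⟨∑ k, Polynomial.C (a k * P.1.1.1 ^ (k.2 : ℕ)) * Polynomial.X ^ (k.1 : ℕ),
      Polynomial.natDegree_sum_le_of_forall_le _ _ fun k _ =>
        (Polynomial.natDegree_C_mul_X_pow_le _ _).trans (by omega), fun Q hQ => ?_⟩
    have hx : Q.1.1.1 = P.1.1.1 := by
      rcases hQ with rfl | hQ
      · rfl
      · exact (mem_orbit_scalingGroup (hy P)).1 hQ.1
    rw [ha, Polynomial.eval_finsetSum]
    refine Finset.sum_congr rfl fun k _ => ?_
    rw [hx]
    simp
    ring

theorem disjoint_puncturedOrbit (hadd : ∀ a b : F, (a + b) ^ q = a ^ q + b ^ q)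
    {P : EvalPoint F q ℓ} (hy : P.1.1.2 ≠ 0) :
    Disjoint (puncturedOrbit (translationGroup F q ℓ) P)
      (puncturedOrbit (scalingGroup F q ℓ) P) := by
  rw [Set.disjoint_left]
  intro Q h1 h2
  exact h1.2 (Subtype.ext (Subtype.ext (Prod.ext ((mem_orbit_scalingGroup hy).1 h2.1)
    ((mem_orbit_translationGroup hadd).1 h1.1))))

/-- Restrict to the grid of points (x₀ + t, c) with t^q + t = 0 and c^(q^ℓ + 1) = 1. Vandermonde in
c isolates each power of y, then Vandermonde in t each power of x. -/
theorem linearIndependent_monomialVec [Finite F]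
    (hadd : ∀ a b : F, (a + b) ^ q = a ^ q + b ^ q)
    (hlong : ∀ P : Point F q ℓ, (MulAction.orbit (fullGroup F q ℓ) P).ncard =
      Nat.card (fullGroup F q ℓ) ↔ P.1.2 ≠ 0)
    (hone : ∃ x : F, 1 = x ^ q + x) {m₁ m₂ : ℕ}
    (hm₁ : m₁ + 1 ≤ Nat.card {c : F // c ^ (q ^ ℓ + 1) = 1})
    (hm₂ : m₂ + 1 ≤ Nat.card {a : F // a ^ q + a = 0}) :
    LinearIndependent F (monomialVec F q ℓ (m₁ := m₁) (m₂ := m₂)) := by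
  obtain ⟨x₀, hx₀⟩ := hone
  rw [Fintype.linearIndependent_iff]
  intro a ha
  have hgrid : ∀ (t : {a : F // a ^ q + a = 0}) (c : {c : F // c ^ (q ^ ℓ + 1) = 1}),
      ∑ i : Fin (m₁ + 1), (∑ j : Fin (m₂ + 1), a (i, j) * (x₀ + t.1) ^ (j : ℕ)) *
        c.1 ^ (i : ℕ) = 0 := by
    intro t c
    have hc0 : c.1 ≠ 0 := by
      intro h
      have := c.2
      rw [h] at this
      simp at this
    let P : Point F q ℓ := ⟨(x₀ + t.1, c.1), by
      rw [c.2, hadd]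
      linear_combination hx₀ - t.2⟩
    let Q : EvalPoint F q ℓ := ⟨P, (hlong P).2 hc0⟩
    have h := congrFun ha Q
    rw [Finset.sum_apply, Fintype.sum_prod_type] at h
    refine Eq.trans ?_ h
    refine Finset.sum_congr rfl fun i _ => ?_
    rw [Finset.sum_mul]
    exact Finset.sum_congr rfl fun j _ => mul_assoc _ _ _
  have hrow : ∀ i (t : {a : F // a ^ q + a = 0}),
      ∑ j : Fin (m₂ + 1), a (i, j) * (x₀ + t.1) ^ (j : ℕ) = 0 := fun i t =>
    congrFun (eq_zero_of_sum_mul_pow_eq_zero Subtype.val_injective hm₁ (hgrid t)) i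
  rintro ⟨i, j⟩
  exact congrFun (eq_zero_of_sum_mul_pow_eq_zero (v := fun j => a (i, j))
    ((add_right_injective x₀).comp Subtype.val_injective) hm₂ (hrow i)) j

theorem le_hammingNorm [Fintype F] [DecidableEq F] (hq : 2 ≤ q) {m₁ m₂ : ℕ}
    {c : EvalPoint F q ℓ → F} (hc : c ∈ evalCode F q ℓ m₁ m₂) (hc0 : c ≠ 0) :
    Fintype.card (EvalPoint F q ℓ) ≤ hammingNorm c + (m₁ * q + m₂ * (q ^ ℓ + 1)) := by
  classical
  obtain ⟨a, ha⟩ := exists_coeff_of_mem_evalCode hc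
  let p : Polynomial (Polynomial F) := ∑ k, Polynomial.C (Polynomial.C (a k) *
    Polynomial.X ^ (k.2 : ℕ)) * Polynomial.X ^ (k.1 : ℕ)
  have hp : ∀ P : EvalPoint F q ℓ, p.evalEval P.1.1.1 P.1.1.2 = c P := by
    intro P
    rw [ha, Polynomial.evalEval_finsetSum]
    refine Finset.sum_congr rfl fun k _ => ?_
    simp [Polynomial.evalEval_mul, Polynomial.evalEval_pow, Polynomial.evalEval_C,
      Polynomial.evalEval_X, mul_assoc]
  have hw : WeightedCurve.WeightLE q (q ^ ℓ + 1) p (m₁ * q + m₂ * (q ^ ℓ + 1)) := by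
    refine WeightedCurve.WeightLE.sum fun k _ => ?_
    refine (WeightedCurve.weightLE_monomial _ _ _).mono ?_
    have h1 := Nat.mul_le_mul_left q (show (k.1 : ℕ) ≤ m₁ by omega)
    have h2 := Nat.mul_le_mul_left (q ^ ℓ + 1) (show (k.2 : ℕ) ≤ m₂ by omega)
    linarith
  -- A nonzero coordinate witnesses that p does not vanish identically on the curve.
  obtain ⟨P₀, hP₀⟩ := Function.ne_iff.1 hc0
  let Z : Finset (EvalPoint F q ℓ) := Finset.univ.filter fun P => c P = 0
  have hinj : Function.Injective fun P : EvalPoint F q ℓ => P.1.1 :=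
    Subtype.val_injective.comp Subtype.val_injective
  have hZ := WeightedCurve.card_zeros_le hq (Nat.succ_ne_zero _) hw
    ⟨_, _, P₀.1.2, by rw [hp]; exact hP₀⟩ (Z.image fun P => P.1.1) (by
      intro u hu
      obtain ⟨P, hP, rfl⟩ := Finset.mem_image.1 hu
      exact ⟨P.1.2, (hp P).trans (Finset.mem_filter.1 hP).2⟩)
  rw [Finset.card_image_of_injective _ hinj] at hZ
  have hsplit : Z.card + hammingNorm c = (Finset.univ : Finset (EvalPoint F q ℓ)).card :=
    Finset.card_filter_add_card_filter_not _
  rw [Finset.card_univ] at hsplit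
  omega

end EvalCode

end GenHermitian

theorem proposition4p5 {F : Type*} [Field F] [Fintype F] [DecidableEq F]
    (q ℓ : ℕ) [NeZero q] (hq : IsPrimePow q) (hq_odd : Odd q) (hl_odd : Odd ℓ)
    (hF : Fintype.card F = q ^ (2 * ℓ))
    (t₁ t₂ M₁ M₂ m₁ m₂ S : ℕ)
    (hM₁ : M₁ = max t₁ (q ^ ℓ - 1)) (hM₂ : M₂ = max t₂ (q - 2))
    (hm₁ : m₁ = min t₁ (q ^ ℓ - 1)) (hm₂ : m₂ = min t₂ (q - 2))
    (hS : S = M₁ * q + M₂ * (q ^ ℓ + 1))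
    (hSn : S ≤ q ^ (2 * ℓ + 1) - q) :
    Nat.card (GenHermitian.translationGroup F q ℓ) = q ∧
    Nat.card (GenHermitian.scalingGroup F q ℓ) = q ^ ℓ + 1 ∧
    IsRecoverableCode (GenHermitian.evalCode F q ℓ m₁ m₂)
      (q ^ (2 * ℓ + 1) - q) ((m₁ + 1) * (m₂ + 1)) (q ^ (2 * ℓ + 1) - q - S)
      ![q - 1, q ^ ℓ] ∧
    ∀ P : GenHermitian.EvalPoint F q ℓ,
      IsRepairSet (GenHermitian.evalCode F q ℓ m₁ m₂) P
        (GenHermitian.puncturedOrbit (GenHermitian.translationGroup F q ℓ) P) ∧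
      IsRepairSet (GenHermitian.evalCode F q ℓ m₁ m₂) P
        (GenHermitian.puncturedOrbit (GenHermitian.scalingGroup F q ℓ) P) := by
  have hq3 : 3 ≤ q := by
    have := hq.one_lt
    obtain ⟨k, hk⟩ := hq_odd
    omega
  have hadd := GenHermitian.add_pow_of_card hq hF
  have hneg := GenHermitian.neg_one_ne_one_of_card (F := F) hq_odd hF
  have habove := GenHermitian.exists_point_above hq hq_odd hl_odd hF
  have hpt : ∃ P : GenHermitian.Point F q ℓ, P.1.2 ≠ 0 := by
    obtain ⟨x, hx⟩ := habove 1
    exact ⟨⟨(x, 1), hx⟩, one_ne_zero⟩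
  have hlong := GenHermitian.orbit_ncard_eq_iff hneg hq_odd hpt
  have hK := GenHermitian.card_translations (F := F) (by omega : 2 ≤ q) hq_odd hF
  have hU := GenHermitian.card_scalings (F := F) hF
  have hT := (GenHermitian.card_translationGroup (ℓ := ℓ) hadd).trans hK
  have hS' := (GenHermitian.card_scalingGroup hpt).trans hU
  have hy : ∀ P : GenHermitian.EvalPoint F q ℓ, P.1.1.2 ≠ 0 := fun P => (hlong P.1).1 P.2
  have hql : 0 < q ^ ℓ := pow_pos (by omega) _
  -- The caps in m₂ and m₁ give m₂ + 1 ≤ q - 1 < q and, in the next line, m₁ + 1 ≤ q^ℓ < q^ℓ + 1: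
  -- each degree is below the number of remaining orbit points.
  have hrT := GenHermitian.isRepairSet_translation (ℓ := ℓ) (m₁ := m₁) (m₂ := m₂) hadd (by omega)
  have hrS := GenHermitian.isRepairSet_scaling (m₁ := m₁) (m₂ := m₂) hy (by omega)
  have hli := GenHermitian.linearIndependent_monomialVec (m₁ := m₁) (m₂ := m₂) hadd hlong
    (by simpa using habove 1) (by omega) (by omega)
  have hlen : Fintype.card (GenHermitian.EvalPoint F q ℓ) = q ^ (2 * ℓ + 1) - q := by
    rw [GenHermitian.card_evalPoint hneg hq_odd habove hadd, hK, hF, Nat.sub_mul, one_mul,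
      pow_succ]
  have hdim : Module.finrank F (GenHermitian.evalCode F q ℓ m₁ m₂) = (m₁ + 1) * (m₂ + 1) := by
    rw [GenHermitian.evalCode_eq_span, finrank_span_eq_card hli, Fintype.card_prod,
      Fintype.card_fin, Fintype.card_fin]
  refine ⟨hT, hS', ⟨hlen, hdim, le_minDist ?_ fun c hc hc0 => ?_, fun P => ?_⟩,
    fun P => ⟨hrT P, hrS P⟩⟩
  · intro h
    rw [h, finrank_bot] at hdim
    exact absurd hdim.symm (by positivity)
  -- The zero count is bounded by m₁ * q + m₂ * (q^ℓ + 1), which is at most S as mᵢ ≤ Mᵢ.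
  · have h := GenHermitian.le_hammingNorm (by omega) hc hc0
    have h1 := Nat.mul_le_mul_right q (show m₁ ≤ M₁ by omega)
    have h2 := Nat.mul_le_mul_right (q ^ ℓ + 1) (show m₂ ≤ M₂ by omega)
    omega
  · have hdisj := GenHermitian.disjoint_puncturedOrbit hadd (hy P)
    refine ⟨![GenHermitian.puncturedOrbit (GenHermitian.translationGroup F q ℓ) P,
      GenHermitian.puncturedOrbit (GenHermitian.scalingGroup F q ℓ) P], ?_, ?_⟩
    · intro a b hab
      fin_cases a <;> fin_cases b
      · exact absurd rfl hab
      · exact hdisj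
      · exact hdisj.symm
      · exact absurd rfl hab
    · intro j
      fin_cases j
      · refine ⟨?_, hrT P⟩
        exact (GenHermitian.ncard_puncturedOrbit le_sup_left P).trans (by rw [hT]; rfl)
      · refine ⟨?_, hrS P⟩
        exact (GenHermitian.ncard_puncturedOrbit le_sup_right P).trans (by rw [hS']; rfl)
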